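/- Let $M\ge 2$, $N=M-2$ and $\tilde b\in\mathbb R\setminus[0,1]$. Let $\mathbf R=\mathbf R(\tilde b)$ be the real tridiagonal $(N+1)\times(N+1)$ matrix whose row $n$ ($0\le n\le N$) has subdiagonal entry $A_n=(n-1-N)(n+N+3)$, diagonal entry $B_n=-n\big((n+1)(1+\tilde b)+2\tilde b+1\big)$ and superdiagonal entry $C_n=(n+1)(n+2)\tilde b$. To an eigenvector $\mathbf c=(c_0,\dots,c_N)$ of $\mathbf R$ for the real eigenvalue $q$ associate the polynomial $p_{\mathbf c}(t)=\sum_{n=0}^{N}c_nt^n$. Then $\mathbf R$ has $M-1$ distinct real eigenvalues. Put $q^\star$ = the largest eigenvalue if $\tilde b<0$, and $q^\star$ = the smallest eigenvalue if $\tilde b>1$. Then $q^\star$ is the optimal choice of $q$, in the following sense. 1. For an eigenvector $\mathbf c$ of $\mathbf R$ with eigenvalue $q$, the polynomial $p_{\mathbf c}$ has degree $M-2$ with all $M-2$ roots (counted with multiplicity) in $(0,1)$ if and only if $q=q^\star$. 2. For every eigenvector $\mathbf c$ with eigenvalue $q^\star$, $p=p_{\mathbf c}$ solves Heun's equation $$p''+\Big(\frac2t+\frac2{t-1}+\frac1{t-\tilde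 b}\Big)p'+\frac{-(M-2)(M+2)\,t-q^\star}{t(t-1)(t-\tilde b)}\,p=0\qquad(t\neq 0,1,\tilde b).$$ 3. There are points $0=t_1<t_2<\dots<t_M=1$ such that for all these $\mathbf c$ the roots of $p_{\mathbf c}$ are $t_2,\dots,t_{M-1}$, each simple. These points form an equilibrium, $$\sum_{2\le i\le M-1,\ i\ne m}\frac{2}{t_m-t_i}=-\frac2{t_m}-\frac2{t_m-1}-\frac1{t_m-\tilde b}\qquad(2\le m\le M-1),$$ and they are the only points $0=t_1<\dots<t_M=1$ that do. 4. These points are the optimal antenna positions in the normalized angular domain: let $A>0$, $y_0>0$, $x_0\ne0$ and $\theta$ be real numbers (aperture of the array, centroid and azimuth of the user array), and put $\varphi(x)=\arctan\frac{x-x_0}{y_0}$, $\varphi_0=\varphi(0)$, $s(x)=\sin(\varphi(x)-\theta)$, $s_{\min}=s(-A/2)$, $s_{\max}=s(A/2)$, $s_0=s(0)$, $a=\cos^2\varphi_0$, $b=\sin(2\varphi_0)/\cos(\varphi_0-\theta)$. Suppose that $\varphi(x)-\theta\in[-\pi/2,\pi/2]$ for $|x|\le A/2$, and that $\tilde b=\dfrac{s_0+a/b-s_{\min}}{s_{\max}-s_{\min}}$.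 Then $s_m=s_{\min}+(s_{\max}-s_{\min})\,t_m$ $(1\le m\le M)$ is the unique maximizer of $$2\sum_{1\le i<j\le M}\log_2(s_j-s_i)+\sum_{m=1}^M\log_2\big(a-b(s_m-s_0)\big)\quad\text{subject to } s_{\min}=s_1<s_2<\dots<s_M=s_{\max},$$ the weighted Fekete problem of antenna placement with the weight $\cos^2(\arcsin s+\theta)$ replaced by its first-order Taylor polynomial at $s_0$. -/

import Mathlib

open Polynomial

noncomputable section

namespace NearField

/-! Throughout, `N = M - 2` is the number of movable interior antennas of an array with
`M ≥ 2` antennas; the two edge antennas are fixed. -/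

/-! ### Heun's equation and its tridiagonal matrix -/

/-- Subdiagonal coefficient `A_n` of the three-term recurrence of Heun's equation. -/
def heunA (α β : ℝ) (n : ℕ) : ℝ := ((n : ℝ) - 1 + α) * ((n : ℝ) - 1 + β)

/-- Diagonal coefficient `B_n`. -/
def heunB (γ δ ε aH : ℝ) (n : ℕ) : ℝ :=
  -(n : ℝ) * (((n : ℝ) - 1 + γ) * (1 + aH) + aH * δ + ε)

/-- Superdiagonal coefficient `C_n`. -/
def heunC (γ aH : ℝ) (n : ℕ) : ℝ := ((n : ℝ) + 1) * ((n : ℝ) + γ) * aH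

/-- The `(N+1) × (N+1)` tridiagonal matrix with rows `(…, A_n, B_n, C_n, …)`, `0 ≤ n ≤ N`. -/
def heunMatrix (N : ℕ) (α β γ δ ε aH : ℝ) : Matrix (Fin (N + 1)) (Fin (N + 1)) ℝ :=
  Matrix.of fun i j =>
    if (j : ℕ) + 1 = (i : ℕ) then heunA α β i
    else if (j : ℕ) = (i : ℕ) then heunB γ δ ε aH i
    else if (j : ℕ) = (i : ℕ) + 1 then heunC γ aH i
    else 0

/-- The polynomial `p` solves Heun's differential equation with the given parameters, away from
the singular points `0`, `1`, `aH`. -/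
def SolvesHeun (α β γ δ ε aH q : ℝ) (p : ℝ[X]) : Prop :=
  ∀ t : ℝ, t ≠ 0 → t ≠ 1 → t ≠ aH →
    (derivative (derivative p)).eval t
      + (γ / t + δ / (t - 1) + ε / (t - aH)) * (derivative p).eval t
      + (α * β * t - q) / (t * (t - 1) * (t - aH)) * p.eval t = 0

/-- The matrix `R` of the antenna problem: `α = -(M-2) = -N`, `β = M+2 = N+4`,
`γ = δ = 2`, `ε = 1`, `aH = bt`. -/
def antennaMatrix (N : ℕ) (bt : ℝ) : Matrix (Fin (N + 1)) (Fin (N + 1)) ℝ :=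
  heunMatrix N (-(N : ℝ)) ((N : ℝ) + 4) 2 2 1 bt

/-- Real eigenvalues of `R`. -/
def eigs (N : ℕ) (bt : ℝ) : Set ℝ :=
  {q | Module.End.HasEigenvalue (Matrix.toLin' (antennaMatrix N bt)) q}

/-- `c` is an eigenvector of `R` (in particular `c ≠ 0`) for the eigenvalue `q`. -/
def IsEigenvector (N : ℕ) (bt q : ℝ) (c : Fin (N + 1) → ℝ) : Prop :=
  Module.End.HasEigenvector (Matrix.toLin' (antennaMatrix N bt)) q c

/-- The polynomial `c₀ + c₁ t + ⋯ + c_N t^N` with coefficient vector `c`. -/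
def coeffPoly {N : ℕ} (c : Fin (N + 1) → ℝ) : ℝ[X] := ∑ m, C (c m) * X ^ (m : ℕ)

/-- `p` has degree `N`, and all of its `N` roots (with multiplicity) are real and lie in `(0,1)`. -/
def AllRootsInUnit (N : ℕ) (p : ℝ[X]) : Prop :=
  p.natDegree = N ∧ Multiset.card p.roots = N ∧ ∀ r ∈ p.roots, 0 < r ∧ r < 1

/-! ### Configurations and electrostatic equilibrium -/

/-- Positions `lo = x₁ < x₂ < ⋯ < x_M = hi` of `M = N + 2` antennas. -/
def IsConfig {N : ℕ} (lo hi : ℝ) (x : Fin (N + 2) → ℝ) : Prop :=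
  StrictMono x ∧ x 0 = lo ∧ x (Fin.last (N + 1)) = hi

/-- The interior positions `x₂, …, x_{M-1}`. -/
def interior {N : ℕ} (x : Fin (N + 2) → ℝ) (m : Fin N) : ℝ := x m.succ.castSucc

/-- Equilibrium of the free charges `τ` in the normalized angular domain, with fixed charges at
`0`, `1` and `bt`. -/
def IsEquilibrium {N : ℕ} (bt : ℝ) (τ : Fin N → ℝ) : Prop :=
  ∀ m, ∑ i ∈ Finset.univ.erase m, 2 / (τ m - τ i)
    = -(2 / τ m) - 2 / (τ m - 1) - 1 / (τ m - bt)

/-! ### Geometry and the antenna placement problem -/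

/-- BS array on the `x`-axis with aperture `A` centred at the origin; UE array with centroid
`(x0, y0)` and azimuth angle `θ`. -/
structure Geometry where
  A : ℝ
  x0 : ℝ
  y0 : ℝ
  θ : ℝ

namespace Geometry

variable (G : Geometry)

/-- The angle `φ` of a BS antenna at abscissa `x`: `tan φ = (x - x0) / y0`. -/
def phi (x : ℝ) : ℝ := Real.arctan ((x - G.x0) / G.y0)

/-- Angular-domain position of a BS antenna at abscissa `x`. -/
def sCoord (x : ℝ) : ℝ := Real.sin (G.phi x - G.θ)

def sMin : ℝ := G.sCoord (-G.A / 2)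
def sMax : ℝ := G.sCoord (G.A / 2)

/-- Expansion point `s₀`, the angular-domain position of the array centre (`tan φ₀ = -x0/y0`). -/
def s0 : ℝ := G.sCoord 0

/-- First-order Taylor data of `w(s) = cos² (arcsin s + θ)` at `s₀`: `w(s) ≃ a - b (s - s₀)`. -/
def a : ℝ := Real.cos (G.phi 0) ^ 2
def b : ℝ := Real.sin (2 * G.phi 0) / Real.cos (G.phi 0 - G.θ)

def bHat : ℝ := G.s0 + G.a / G.b
def bTilde : ℝ := (G.bHat - G.sMin) / (G.sMax - G.sMin)

/-- Standing assumptions: positive aperture, the UE in front of the array, every angle `φ - θ` in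
`[-π/2, π/2]` (it is enough to say so at the two edges), and `x0 ≠ 0`, i.e. `b ≠ 0`, without
which `bHat` is not defined. -/
def Admissible : Prop :=
  0 < G.A ∧ 0 < G.y0 ∧ G.x0 ≠ 0 ∧
    -(Real.pi / 2) ≤ G.phi (-G.A / 2) - G.θ ∧ G.phi (G.A / 2) - G.θ ≤ Real.pi / 2

/-- The weighted Fekete objective with the weight replaced by its first-order expansion. -/
def objective {N : ℕ} (s : Fin (N + 2) → ℝ) : ℝ :=
  2 * ∑ i, ∑ j ∈ Finset.Ioi i, Real.logb 2 (s j - s i)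
    + ∑ m, Real.logb 2 (G.a - G.b * (s m - G.s0))

/-- From the normalized angular domain back to the angular domain. -/
def denormalize {N : ℕ} (t : Fin (N + 2) → ℝ) : Fin (N + 2) → ℝ :=
  fun m => G.sMin + (G.sMax - G.sMin) * t m

/-- `s` is feasible and is the one and only maximizer of the objective. -/
def IsUniqueOptimum {N : ℕ} (s : Fin (N + 2) → ℝ) : Prop :=
  IsConfig G.sMin G.sMax s ∧
    ∀ s' : Fin (N + 2) → ℝ, IsConfig G.sMin G.sMax s' → s' ≠ s → G.objective s' < G.objective s

end Geometry

/-! ### Optimal choice of the eigenvalue -/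

/-- The eigenvalue `q` of `R` is the optimal choice:
* among all eigenpairs of `R`, those with eigenvalue `q`, and only those, give a polynomial with
  all of its `N` roots in `(0,1)`;
* the polynomials obtained from `q` solve Heun's equation, and their roots are the interior
  points of a normalized configuration `0 = t₁ < ⋯ < t_M = 1` that is the only
  equilibrium configuration, and that is the optimal placement for every geometry with
  parameter `bt`. -/
def IsOptimalChoice (N : ℕ) (bt q : ℝ) : Prop :=
  q ∈ eigs N bt ∧
  (∀ (q' : ℝ) (c : Fin (N + 1) → ℝ), IsEigenvector N bt q' c →
    (AllRootsInUnit N (coeffPoly c) ↔ q' = q)) ∧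
  (∀ c : Fin (N + 1) → ℝ, IsEigenvector N bt q c →
    SolvesHeun (-(N : ℝ)) ((N : ℝ) + 4) 2 2 1 bt q (coeffPoly c)) ∧
  ∃ t : Fin (N + 2) → ℝ, IsConfig 0 1 t ∧
    (∀ c : Fin (N + 1) → ℝ, IsEigenvector N bt q c →
      (coeffPoly c).roots = (Finset.univ : Finset (Fin N)).val.map (interior t)) ∧
    IsEquilibrium bt (interior t) ∧
    (∀ t' : Fin (N + 2) → ℝ, IsConfig 0 1 t' → IsEquilibrium bt (interior t') → t' = t) ∧
    (∀ G : Geometry, G.Admissible → G.bTilde = bt → G.IsUniqueOptimum (G.denormalize t))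

end NearField

end

/-! Stieltjes' electrostatic argument carries the proof. For `b` outside `[0,1]` the logarithmic
energy is strictly concave on ordered configurations with fixed ends (`Real.log` is `log |·|`, so `b
> 1` needs no separate energy). Compactness gives a maximizer and its interior forces vanish, which
is the equilibrium (`exists_equilibrium`). By the tangent-line bound `log x ≤ x - 1` every
equilibrium strictly beats all other configurations (`logEnergy_lt_of_equilibrium`), hence it is
unique. The angular-domain objective is this energy up to an affine change of variable, a positive
factor and a constant (`objective_denormalize`).

For `p = ∏ (X - τ i)` the equilibrium says that `heunOp N b p` vanishes at every root of `p`
(`eval_heunOp_prod`). As `heunOp` preserves degree at most `N`, it follows that `heunOp N b p = q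
p`, an eigenvector equation since the matrix is `heunOp` in the monomial basis. Conversely, an
eigenpolynomial with all roots in `(0,1)` has simple roots, which form an equilibrium, hence the
same one. So exactly one eigenvalue has this property.

It is extremal by a Perron–Frobenius argument: for `b < 0` the off-diagonal entries are nonpositive,
while the coefficients of `p` alternate in sign (`eigenvalue_le_of_mulVec_eq`). All `N + 1`
eigenvalues are real and distinct because the matrix is diagonally similar to a symmetric one and
the recurrence makes eigenspaces lines. The reflection `t ↦ 1 - t` carries `b > 1` to `1 - b < 0`
and reverses the order of eigenvalues. -/

noncomputable section

namespace NearField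


/-! ### The logarithmic energy -/

/-- Logarithmic energy of charges at `t`, in the field of a further charge at `b`. -/
def logEnergy {n : ℕ} (b : ℝ) (t : Fin n → ℝ) : ℝ :=
  2 * ∑ i, ∑ j ∈ Finset.Ioi i, Real.log (t j - t i) + ∑ m, Real.log (t m - b)

/-- Partial derivative of `logEnergy b` in the position of the charge `m`. -/
def force {n : ℕ} (b : ℝ) (t : Fin n → ℝ) (m : Fin n) : ℝ :=
  ∑ i, 2 / (t m - t i) + 1 / (t m - b)

lemma sum_eq_two_mul_sum_Ioi {n : ℕ} (f : Fin n → Fin n → ℝ) (h0 : ∀ i, f i i = 0)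
    (hs : ∀ i j, f i j = f j i) :
    ∑ i, ∑ j, f i j = 2 * ∑ i, ∑ j ∈ Finset.Ioi i, f i j := by
  have h1 : ∀ i, ∑ j, f i j = ∑ j ∈ Finset.Ioi i, f i j + ∑ j ∈ Finset.Iio i, f i j := by
    intro i
    rw [← Finset.sum_union]
    · rw [← Finset.sum_erase (a := i) _ (h0 i)]
      refine Finset.sum_congr ?_ fun _ _ => rfl
      ext j
      simp [lt_or_lt_iff_ne, eq_comm]
    · rw [Finset.disjoint_left]
      intro a ha hb
      simp only [Finset.mem_Ioi, Finset.mem_Iio] at ha hb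
      exact lt_asymm ha hb
  have h2 : ∑ i, ∑ j ∈ Finset.Iio i, f i j = ∑ i, ∑ j ∈ Finset.Ioi i, f i j := by
    rw [Finset.sum_comm' (s' := fun j => Finset.Ioi j) (t' := Finset.univ) (by simp)]
    exact Finset.sum_congr rfl fun i _ => Finset.sum_congr rfl fun j _ => hs _ _
  rw [Finset.sum_congr rfl fun i _ => h1 i, Finset.sum_add_distrib, h2, two_mul]

/-- The kernel `1 / (t m - t i)` is odd, so splitting `2 / (t m - t i)` into two copies and swapping
the indices in one of them leaves differences of `v`. This form of the directional derivative serves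
both the concavity bound and the differentiation. -/
lemma sum_mul_force {n : ℕ} (b : ℝ) (t v : Fin n → ℝ) :
    ∑ m, v m * force b t m =
      2 * ∑ i, ∑ j ∈ Finset.Ioi i, (v j - v i) / (t j - t i) + ∑ m, v m / (t m - b) := by
  rw [← sum_eq_two_mul_sum_Ioi (fun i j => (v j - v i) / (t j - t i)) (by simp)
    (fun i j => by rw [← neg_sub (v i), ← neg_sub (t i), neg_div_neg_eq])]
  have h : ∀ m, v m * force b t m =
      (∑ i, v m / (t m - t i) + ∑ i, v m / (t m - t i)) + v m / (t m - b) := by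
    intro m
    rw [force, mul_add, Finset.mul_sum, ← Finset.sum_add_distrib]
    congr 1
    · exact Finset.sum_congr rfl fun i _ => by ring
    · ring
  rw [Finset.sum_congr rfl fun m _ => h m, Finset.sum_add_distrib, Finset.sum_add_distrib]
  congr 1
  nth_rw 1 [Finset.sum_comm]
  rw [← Finset.sum_add_distrib]
  refine Finset.sum_congr rfl fun i _ => ?_
  rw [← Finset.sum_add_distrib]
  refine Finset.sum_congr rfl fun j _ => ?_
  rw [sub_div, ← neg_sub (t j) (t i), div_neg]
  ring

lemma IsConfig.mem_Icc {N : ℕ} {lo hi : ℝ} {t : Fin (N + 2) → ℝ} (h : IsConfig lo hi t)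
    (m : Fin (N + 2)) : lo ≤ t m ∧ t m ≤ hi :=
  ⟨h.2.1 ▸ h.1.monotone (Fin.zero_le m), h.2.2 ▸ h.1.monotone (Fin.le_last m)⟩

lemma isEquilibrium_interior_iff {N : ℕ} {b : ℝ} {t : Fin (N + 2) → ℝ} (ht : IsConfig 0 1 t) :
    IsEquilibrium b (interior t) ↔ ∀ m : Fin N, force b t m.succ.castSucc = 0 := by
  refine forall_congr' fun m => ?_
  -- The self-term of `force` is `2 / 0 = 0`; the two end charges contribute `2 / τ` and `2 / (τ -
  -- 1)`.
  rw [Finset.sum_erase _ (by simp), force, Fin.sum_univ_castSucc, Fin.sum_univ_succ,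
    Fin.castSucc_zero, ht.2.1, ht.2.2]
  simp only [interior, sub_zero]
  constructor <;> intro h <;> linarith

/-- For `b` outside `[0,1]`, ratios `(x - b) / (y - b)` of points of `[0,1]` are positive. -/
lemma div_sub_pos {b x y : ℝ} (hb : b < 0 ∨ 1 < b) (hx : 0 ≤ x ∧ x ≤ 1) (hy : 0 ≤ y ∧ y ≤ 1) :
    0 < (x - b) / (y - b) := by
  rcases hb with hb | hb
  · exact div_pos (by linarith) (by linarith)
  · exact div_pos_of_neg_of_neg (by linarith) (by linarith)

lemma sub_ne_zero_of_mem {b x : ℝ} (hb : b < 0 ∨ 1 < b) (hx : 0 ≤ x ∧ x ≤ 1) : x - b ≠ 0 := by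
  rcases hb with hb | hb
  · exact (by linarith : 0 < x - b).ne'
  · exact (by linarith : x - b < 0).ne

/-- By concavity, an equilibrium has strictly larger energy than any other configuration. -/
lemma logEnergy_lt_of_equilibrium {N : ℕ} {b : ℝ} (hb : b < 0 ∨ 1 < b) {t t' : Fin (N + 2) → ℝ}
    (ht : IsConfig 0 1 t) (he : IsEquilibrium b (interior t)) (ht' : IsConfig 0 1 t')
    (hne : t' ≠ t) : logEnergy b t' < logEnergy b t := by
  have hf := (isEquilibrium_interior_iff ht).1 he
  -- The directional derivative at `t` towards `t'` is zero: the ends do not move and the interior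
  -- forces vanish.
  have hz : ∑ m, (t' m - t m) * force b t m = 0 := by
    rw [Fin.sum_univ_castSucc, Fin.sum_univ_succ, Fin.castSucc_zero, ht.2.1, ht.2.2, ht'.2.1,
      ht'.2.2, Finset.sum_eq_zero fun m _ => by rw [hf m, mul_zero]]
    ring
  rw [sum_mul_force b t (fun m => t' m - t m)] at hz
  have h1 : ∑ i, ∑ j ∈ Finset.Ioi i, Real.log (t' j - t' i) ≤
      ∑ i, ∑ j ∈ Finset.Ioi i, Real.log (t j - t i)
        + ∑ i, ∑ j ∈ Finset.Ioi i, ((t' j - t j) - (t' i - t i)) / (t j - t i) := by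
    rw [← Finset.sum_add_distrib]
    refine Finset.sum_le_sum fun i _ => ?_
    rw [← Finset.sum_add_distrib]
    refine Finset.sum_le_sum fun j hj => ?_
    have hj := Finset.mem_Ioi.1 hj
    have p : 0 < t j - t i := sub_pos.2 (ht.1 hj)
    have p' : 0 < t' j - t' i := sub_pos.2 (ht'.1 hj)
    have := Real.log_le_sub_one_of_pos (div_pos p' p)
    rw [Real.log_div p'.ne' p.ne'] at this
    have e : ((t' j - t j) - (t' i - t i)) / (t j - t i) = (t' j - t' i) / (t j - t i) - 1 := by
      field_simp; ring
    linarith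
  have key : ∀ m, Real.log (t' m - b) = Real.log (t m - b) + Real.log ((t' m - b) / (t m - b)) := by
    intro m
    rw [Real.log_div (sub_ne_zero_of_mem hb (ht'.mem_Icc m)) (sub_ne_zero_of_mem hb (ht.mem_Icc m))]
    ring
  have e : ∀ m, (t' m - t m) / (t m - b) = (t' m - b) / (t m - b) - 1 := by
    intro m
    have := sub_ne_zero_of_mem hb (ht.mem_Icc m)
    field_simp; ring
  have h2 : ∑ m, Real.log (t' m - b) <
      ∑ m, Real.log (t m - b) + ∑ m, (t' m - t m) / (t m - b) := by
    rw [← Finset.sum_add_distrib]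
    -- Strictness comes from the external charge alone: a moved point has ratio `(t' - b) / (t - b)
    -- ≠ 1`.
    obtain ⟨m₀, hm₀⟩ := Function.ne_iff.1 hne
    refine Finset.sum_lt_sum (fun m _ => ?_) ⟨m₀, Finset.mem_univ _, ?_⟩
    · rw [key, e]
      have := Real.log_le_sub_one_of_pos (div_sub_pos hb (ht'.mem_Icc m) (ht.mem_Icc m))
      linarith
    · rw [key, e]
      have hne1 : (t' m₀ - b) / (t m₀ - b) ≠ 1 := by
        rw [Ne, div_eq_one_iff_eq (sub_ne_zero_of_mem hb (ht.mem_Icc m₀))]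
        intro h
        exact hm₀ (by linarith)
      have := Real.log_lt_sub_one_of_pos (div_sub_pos hb (ht'.mem_Icc m₀) (ht.mem_Icc m₀)) hne1
      linarith
  unfold logEnergy
  linarith

lemma hasDerivAt_logEnergy {n : ℕ} {b : ℝ} {t : Fin n → ℝ} (ht : StrictMono t)
    (hb : ∀ m, t m - b ≠ 0) (v : Fin n → ℝ) :
    HasDerivAt (fun x : ℝ => logEnergy b (fun m => t m + x * v m)) (∑ m, v m * force b t m) 0 := by
  rw [sum_mul_force]
  unfold logEnergy
  have lin : ∀ m, HasDerivAt (fun x : ℝ => t m + x * v m) (v m) 0 := fun m => by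
    simpa using ((hasDerivAt_id (0 : ℝ)).mul_const (v m)).const_add (t m)
  refine HasDerivAt.add (HasDerivAt.const_mul 2 ?_) ?_
  · refine HasDerivAt.fun_sum fun i _ => HasDerivAt.fun_sum fun j hj => ?_
    have := ((lin j).sub (lin i)).log
      (by simpa using (sub_pos.2 (ht (Finset.mem_Ioi.1 hj))).ne')
    simpa using this
  · refine HasDerivAt.fun_sum fun m _ => ?_
    simpa using ((lin m).sub_const b).log (by simpa using hb m)

/-- Among the ordered tuples in `[0,1]` with fixed ends, some configuration maximizes the energy. -/
lemma exists_config_isMax (N : ℕ) {b : ℝ} (hb : b < 0 ∨ 1 < b) :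
    ∃ t : Fin (N + 2) → ℝ, IsConfig 0 1 t ∧
      ∀ t' : Fin (N + 2) → ℝ, IsConfig 0 1 t' → logEnergy b t' ≤ logEnergy b t := by
  -- The exponential of the energy extends continuously to collisions, where it is zero, so it can
  -- be maximized on the compact set of monotone tuples.
  let P : (Fin (N + 2) → ℝ) → ℝ := fun t =>
    (∏ i, ∏ j ∈ Finset.Ioi i, (t j - t i)) ^ 2 * ∏ m, |t m - b|
  let K : Set (Fin (N + 2) → ℝ) := {t | Monotone t ∧ t 0 = 0 ∧ t (Fin.last (N + 1)) = 1}
  have hP : Continuous P := by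
    simp only [P]
    fun_prop
  have hKc : IsClosed K := by
    have : K = {t | Monotone t} ∩ ({t | t 0 = 0} ∩ {t | t (Fin.last (N + 1)) = 1}) := rfl
    rw [this]
    refine isClosed_monotone.inter (IsClosed.inter ?_ ?_) <;>
      exact isClosed_eq (by fun_prop) continuous_const
  have hKb : K ⊆ Set.Icc (fun _ => 0) (fun _ => 1) := fun t ht =>
    ⟨fun m => ht.2.1.symm.trans_le (ht.1 (Fin.zero_le m)),
      fun m => (ht.1 (Fin.le_last m)).trans_eq ht.2.2⟩
  have hK : IsCompact K := isCompact_Icc.of_isClosed_subset hKc hKb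
  have hsub : ∀ t, IsConfig 0 1 t → t ∈ K := fun t ht => ⟨ht.1.monotone, ht.2⟩
  have hexp : ∀ t, IsConfig 0 1 t → 0 < P t ∧ Real.log (P t) = logEnergy b t := by
    intro t ht
    have hd : ∀ i, ∀ j ∈ Finset.Ioi i, t j - t i ≠ 0 := fun i j hj =>
      (sub_pos.2 (ht.1 (Finset.mem_Ioi.1 hj))).ne'
    have hd1 : ∀ i, ∏ j ∈ Finset.Ioi i, (t j - t i) ≠ 0 := fun i => Finset.prod_ne_zero_iff.2 (hd i)
    have hd2 : ∏ i, ∏ j ∈ Finset.Ioi i, (t j - t i) ≠ 0 :=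
      Finset.prod_ne_zero_iff.2 fun i _ => hd1 i
    have hbm : ∀ m, |t m - b| ≠ 0 := fun m => abs_ne_zero.2 (sub_ne_zero_of_mem hb (ht.mem_Icc m))
    have hb2 : ∏ m, |t m - b| ≠ 0 := Finset.prod_ne_zero_iff.2 fun m _ => hbm m
    refine ⟨mul_pos (by positivity) (Finset.prod_pos fun m _ => (abs_nonneg _).lt_of_ne' (hbm m)), ?_⟩
    simp only [P, logEnergy]
    rw [Real.log_mul (pow_ne_zero _ hd2) hb2, Real.log_pow, Real.log_prod fun i _ => hd1 i,
      Real.log_prod fun m _ => hbm m]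
    congr 1
    · push_cast
      congr 1
      exact Finset.sum_congr rfl fun i _ => Real.log_prod (hd i)
    · simp
  -- Equally spaced points show that the maximum is positive, which excludes collisions at the
  -- maximizer.
  let u : Fin (N + 2) → ℝ := fun m => (m : ℕ) / ((N : ℝ) + 1)
  have hu : IsConfig 0 1 u := by
    have hN : (0 : ℝ) < N + 1 := by positivity
    refine ⟨fun i j hij => ?_, by simp [u], ?_⟩
    · exact div_lt_div_of_pos_right (by exact_mod_cast hij) hN
    · simp only [u, Fin.val_last]
      push_cast
      exact div_self hN.ne'
  obtain ⟨t, htK, hmax⟩ := hK.exists_isMaxOn ⟨u, hsub u hu⟩ hP.continuousOn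
  have hpos : 0 < P t := (hexp u hu).1.trans_le (hmax (hsub u hu))
  have ht : IsConfig 0 1 t := by
    refine ⟨htK.1.strictMono_of_injective fun i j hij => ?_, htK.2⟩
    by_contra hne
    refine hpos.ne' ?_
    wlog hlt : i < j generalizing i j
    · exact this j i hij.symm (Ne.symm hne) (lt_of_le_of_ne (not_lt.1 hlt) (Ne.symm hne))
    simp only [P]
    rw [Finset.prod_eq_zero (Finset.mem_univ i)
      (Finset.prod_eq_zero (Finset.mem_Ioi.2 hlt) (by rw [hij, sub_self]))]
    simp
  refine ⟨t, ht, fun t' ht' => ?_⟩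
  rw [← (hexp t ht).2, ← (hexp t' ht').2]
  exact Real.log_le_log (hexp t' ht').1 (hmax (hsub t' ht'))

/-- A small displacement of one interior point keeps the order and the ends, so at a maximizer the
force on that point vanishes. -/
lemma exists_equilibrium (N : ℕ) {b : ℝ} (hb : b < 0 ∨ 1 < b) :
    ∃ t : Fin (N + 2) → ℝ, IsConfig 0 1 t ∧ IsEquilibrium b (interior t) := by
  obtain ⟨t, ht, hmax⟩ := exists_config_isMax N hb
  refine ⟨t, ht, (isEquilibrium_interior_iff ht).2 fun k => ?_⟩
  set m : Fin (N + 2) := k.succ.castSucc with hm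
  have h0m : (0 : Fin (N + 2)) ≠ m := by
    rw [hm, Ne, Fin.ext_iff]; simp
  have hlm : Fin.last (N + 1) ≠ m := by
    rw [hm]; exact (Fin.castSucc_lt_last _).ne'
  have hd := hasDerivAt_logEnergy ht.1 (fun m => sub_ne_zero_of_mem hb (ht.mem_Icc m))
    (Pi.single m 1)
  have hforce : ∑ i, (Pi.single m 1 : Fin (N + 2) → ℝ) i * force b t i = force b t m := by
    simp [Pi.single_apply]
  rw [hforce] at hd
  refine IsLocalMax.hasDerivAt_eq_zero ?_ hd
  have hmono : ∀ᶠ x : ℝ in nhds 0,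
      StrictMono fun i => t i + x * (Pi.single m 1 : Fin (N + 2) → ℝ) i := by
    have : ∀ i j : Fin (N + 2), i < j → ∀ᶠ x : ℝ in nhds 0,
        t i + x * (Pi.single m 1 : Fin (N + 2) → ℝ) i
          < t j + x * (Pi.single m 1 : Fin (N + 2) → ℝ) j := by
      intro i j hij
      refine ContinuousAt.eventually_lt (by fun_prop) (by fun_prop) ?_
      simpa using ht.1 hij
    have h2 := Filter.eventually_all.2 fun i => Filter.eventually_all.2 fun j =>
      Filter.eventually_all.2 fun hij => this i j hij
    filter_upwards [h2] with x hx i j hij using hx i j hij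
  filter_upwards [hmono] with x hx
  have := hmax _ ⟨hx, by simp [h0m, ht.2.1], by simp [hlm, ht.2.2]⟩
  simpa using this

lemma equilibrium_unique {N : ℕ} {b : ℝ} (hb : b < 0 ∨ 1 < b) {t t' : Fin (N + 2) → ℝ}
    (ht : IsConfig 0 1 t) (he : IsEquilibrium b (interior t)) (ht' : IsConfig 0 1 t')
    (he' : IsEquilibrium b (interior t')) : t' = t := by
  by_contra hne
  exact lt_asymm (logEnergy_lt_of_equilibrium hb ht he ht' hne)
    (logEnergy_lt_of_equilibrium hb ht' he' ht (Ne.symm hne))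

/-! ### Optimality in the angular domain -/

namespace Geometry

variable {G : Geometry}

lemma phi_strictMono (hy : 0 < G.y0) : StrictMono G.phi := fun _ _ h =>
  Real.arctan_strictMono (div_lt_div_of_pos_right (by linarith) hy)

lemma Admissible.sMin_lt_sMax (hG : G.Admissible) : G.sMin < G.sMax := by
  obtain ⟨hA, hy, -, h1, h2⟩ := hG
  have hp := phi_strictMono hy (show -G.A / 2 < G.A / 2 by linarith)
  exact Real.sin_lt_sin_of_lt_of_le_pi_div_two h1 h2 (by linarith)

/-- `sin 2φ₀ = 2 sin φ₀ cos φ₀` is nonzero because `x0 ≠ 0`. The denominator is positive because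
`φ₀` lies strictly between the two edge angles. -/
lemma Admissible.b_ne_zero (hG : G.Admissible) : G.b ≠ 0 := by
  obtain ⟨hA, hy, hx, h1, h2⟩ := hG
  have hp1 := phi_strictMono hy (show -G.A / 2 < 0 by linarith)
  have hp2 := phi_strictMono hy (show 0 < G.A / 2 by linarith)
  refine div_ne_zero ?_ (Real.cos_pos_of_mem_Ioo ⟨by linarith, by linarith⟩).ne'
  rw [Real.sin_two_mul]
  refine mul_ne_zero (mul_ne_zero two_ne_zero ?_) (Real.cos_arctan_pos _).ne'
  rw [phi, Real.sin_arctan]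
  refine div_ne_zero (div_ne_zero (by simpa using hx) hy.ne') ?_
  positivity

lemma objective_denormalize (hG : G.Admissible) {N : ℕ} (t : Fin (N + 2) → ℝ) (ht : IsConfig 0 1 t)
    (hb : G.bTilde < 0 ∨ 1 < G.bTilde) :
    G.objective (G.denormalize t) * Real.log 2 =
      logEnergy G.bTilde t + (2 * ∑ i : Fin (N + 2), ∑ _j ∈ Finset.Ioi i,
        Real.log (G.sMax - G.sMin) + ∑ _m : Fin (N + 2), Real.log (G.b * (G.sMax - G.sMin))) := by
  have hΔ := sub_pos.2 hG.sMin_lt_sMax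
  have hb0 := hG.b_ne_zero
  have hl2 : Real.log 2 ≠ 0 := (Real.log_pos one_lt_two).ne'
  have e1 : ∀ i, ∀ j ∈ Finset.Ioi i, Real.logb 2 (G.denormalize t j - G.denormalize t i)
      * Real.log 2 = Real.log (t j - t i) + Real.log (G.sMax - G.sMin) := by
    intro i j hj
    rw [Real.logb, div_mul_cancel₀ _ hl2, add_comm, ← Real.log_mul hΔ.ne'
      (sub_pos.2 (ht.1 (Finset.mem_Ioi.1 hj))).ne']
    congr 1
    simp only [denormalize]; ring
  have e2 : ∀ m, Real.logb 2 (G.a - G.b * (G.denormalize t m - G.s0)) * Real.log 2 =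
      Real.log (t m - G.bTilde) + Real.log (G.b * (G.sMax - G.sMin)) := by
    intro m
    -- The linearized weight is `-b (sMax - sMin) (t m - bTilde)`; its sign is invisible to
    -- `Real.log`.
    rw [Real.logb, div_mul_cancel₀ _ hl2, add_comm, ← Real.log_mul (mul_ne_zero hb0 hΔ.ne')
      (sub_ne_zero_of_mem hb (ht.mem_Icc m)), ← Real.log_neg_eq_log]
    congr 1
    simp only [denormalize, bTilde, bHat]
    have := hΔ.ne'
    field_simp
    ring
  unfold objective logEnergy
  rw [add_mul, mul_assoc, Finset.sum_mul, Finset.sum_mul, Finset.sum_congr rfl fun m _ => e2 m,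
    Finset.sum_add_distrib]
  have : ∀ i : Fin (N + 2), (∑ j ∈ Finset.Ioi i,
      Real.logb 2 (G.denormalize t j - G.denormalize t i)) * Real.log 2 =
      ∑ j ∈ Finset.Ioi i, Real.log (t j - t i) +
        ∑ _j ∈ Finset.Ioi i, Real.log (G.sMax - G.sMin) := by
    intro i
    rw [Finset.sum_mul, Finset.sum_congr rfl (e1 i), Finset.sum_add_distrib]
  rw [Finset.sum_congr rfl fun i _ => this i, Finset.sum_add_distrib]
  ring

lemma denormalize_isConfig (hG : G.Admissible) {N : ℕ} {t : Fin (N + 2) → ℝ}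
    (ht : IsConfig 0 1 t) : IsConfig G.sMin G.sMax (G.denormalize t) := by
  have hΔ := sub_pos.2 hG.sMin_lt_sMax
  refine ⟨fun i j hij => ?_, by simp [denormalize, ht.2.1], by simp [denormalize, ht.2.2]⟩
  have := mul_lt_mul_of_pos_left (ht.1 hij) hΔ
  simp only [denormalize]
  linarith

lemma exists_denormalize_eq (hG : G.Admissible) {N : ℕ} {s : Fin (N + 2) → ℝ}
    (hs : IsConfig G.sMin G.sMax s) : ∃ t, IsConfig 0 1 t ∧ G.denormalize t = s := by
  have hΔ := sub_pos.2 hG.sMin_lt_sMax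
  refine ⟨fun m => (s m - G.sMin) / (G.sMax - G.sMin), ⟨fun i j hij => ?_, ?_, ?_⟩, ?_⟩
  · exact div_lt_div_of_pos_right (by linarith [hs.1 hij]) hΔ
  · simp [hs.2.1]
  · simp only [hs.2.2]; exact div_self hΔ.ne'
  · funext m
    simp only [denormalize]
    have := hΔ.ne'
    field_simp
    ring

lemma isUniqueOptimum_of_equilibrium (hG : G.Admissible) (hb : G.bTilde < 0 ∨ 1 < G.bTilde)
    {N : ℕ} {t : Fin (N + 2) → ℝ} (ht : IsConfig 0 1 t)
    (he : IsEquilibrium G.bTilde (interior t)) : G.IsUniqueOptimum (G.denormalize t) := by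
  refine ⟨denormalize_isConfig hG ht, fun s' hs' hne => ?_⟩
  obtain ⟨t', ht', rfl⟩ := exists_denormalize_eq hG hs'
  have hlt := logEnergy_lt_of_equilibrium hb ht he ht' fun h => hne (by rw [h])
  have e := objective_denormalize hG t ht hb
  have e' := objective_denormalize hG t' ht' hb
  exact lt_of_mul_lt_mul_right (by linarith) (Real.log_pos one_lt_two).le

end Geometry


/-! ### Heun's operator on polynomials -/

/-- Heun's operator, with the singular denominators cleared, for the antenna parameters. -/
def heunOp (N : ℕ) (b : ℝ) (p : ℝ[X]) : ℝ[X] :=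
  X * (X - 1) * (X - C b) * derivative (derivative p)
    + (5 * X ^ 2 - C (4 * b + 3) * X + C (2 * b)) * derivative p - C ((N : ℝ) * (N + 4)) * (X * p)

lemma heunOp_C_mul (N : ℕ) (b a : ℝ) (p : ℝ[X]) : heunOp N b (C a * p) = C a * heunOp N b p := by
  simp only [heunOp, derivative_C_mul]
  ring

lemma heunOp_sub (N : ℕ) (b : ℝ) (p r : ℝ[X]) :
    heunOp N b (p - r) = heunOp N b p - heunOp N b r := by
  simp only [heunOp, derivative_sub]
  ring

lemma heunOp_eq (N : ℕ) (b : ℝ) (p : ℝ[X]) : heunOp N b p =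
    X * (X * (X * derivative (derivative p))) - C (1 + b) * (X * (X * derivative (derivative p)))
      + C b * (X * derivative (derivative p)) + C 5 * (X * (X * derivative p))
      - C (4 * b + 3) * (X * derivative p) + C (2 * b) * derivative p
      - C ((N : ℝ) * (N + 4)) * (X * p) := by
  simp only [heunOp, map_add, map_mul, map_one, map_ofNat]
  ring

lemma heunOp_coeff_zero (N : ℕ) (b : ℝ) (p : ℝ[X]) :
    (heunOp N b p).coeff 0 = 2 * b * p.coeff 1 := by
  rw [heunOp_eq]
  simp [coeff_derivative]

lemma heunOp_coeff_succ (N : ℕ) (b : ℝ) (p : ℝ[X]) (n : ℕ) :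
    (heunOp N b p).coeff (n + 1) =
      heunA (-(N : ℝ)) ((N : ℝ) + 4) (n + 1) * p.coeff n + heunB 2 2 1 b (n + 1) * p.coeff (n + 1)
        + heunC 2 b (n + 1) * p.coeff (n + 2) := by
  rw [heunOp_eq]
  simp only [heunA, heunB, heunC]
  -- Up to three factors `X` shift the index, so coefficients `1` and `2` are treated apart.
  rcases n with _ | _ | n
  · simp only [coeff_add, coeff_sub, coeff_C_mul, coeff_X_mul, coeff_derivative, mul_coeff_zero,
      coeff_X_zero]
    push_cast
    ring
  · simp only [coeff_add, coeff_sub, coeff_C_mul, coeff_X_mul, coeff_derivative, mul_coeff_zero,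
      coeff_X_zero]
    push_cast
    ring
  · simp only [coeff_add, coeff_sub, coeff_C_mul, coeff_X_mul, coeff_derivative]
    push_cast
    ring

/-- Only the subdiagonal term can raise the degree, and `α = -N` makes `A_{N+1} = 0`. -/
lemma heunOp_coeff_of_lt {N : ℕ} (b : ℝ) {p : ℝ[X]} (hp : p.natDegree ≤ N) {n : ℕ} (hn : N < n) :
    (heunOp N b p).coeff n = 0 := by
  obtain ⟨n, rfl⟩ : ∃ k, n = k + 1 := ⟨n - 1, by omega⟩
  rw [heunOp_coeff_succ, coeff_eq_zero_of_natDegree_lt (n := n + 1) (by omega),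
    coeff_eq_zero_of_natDegree_lt (n := n + 2) (by omega)]
  rcases (by omega : n = N ∨ N < n) with rfl | h
  · simp [heunA]
  · rw [coeff_eq_zero_of_natDegree_lt (n := n) (by omega)]
    simp

/-! ### Eigenvectors as polynomials -/

lemma coeff_coeffPoly {N : ℕ} (c : Fin (N + 1) → ℝ) (m : Fin (N + 1)) :
    (coeffPoly c).coeff m = c m := by
  simp only [coeffPoly, finsetSum_coeff, coeff_C_mul, coeff_X_pow]
  simp [← Fin.ext_iff]

lemma natDegree_coeffPoly_le {N : ℕ} (c : Fin (N + 1) → ℝ) : (coeffPoly c).natDegree ≤ N :=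
  natDegree_sum_le_of_forall_le _ _ fun m _ =>
    (natDegree_C_mul_X_pow_le _ _).trans (Nat.lt_succ_iff.1 m.2)

lemma coeffPoly_coeff {N : ℕ} {p : ℝ[X]} (hp : p.natDegree ≤ N) :
    coeffPoly (fun m : Fin (N + 1) => p.coeff m) = p := by
  ext n
  by_cases hn : n ≤ N
  · exact coeff_coeffPoly (fun m : Fin (N + 1) => p.coeff m) ⟨n, by omega⟩
  · rw [coeff_eq_zero_of_natDegree_lt ((natDegree_coeffPoly_le _).trans_lt (not_le.1 hn)),
      coeff_eq_zero_of_natDegree_lt (by omega)]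

lemma coeffPoly_eq_zero_iff {N : ℕ} (c : Fin (N + 1) → ℝ) : coeffPoly c = 0 ↔ c = 0 := by
  constructor
  · intro h
    funext m
    rw [← coeff_coeffPoly c m, h]
    simp
  · rintro rfl
    simp [coeffPoly]

lemma antennaMatrix_mulVec (N : ℕ) (b : ℝ) (c : Fin (N + 1) → ℝ) (i : Fin (N + 1)) :
    (antennaMatrix N b).mulVec c i = (heunOp N b (coeffPoly c)).coeff i := by
  set p := coeffPoly c with hp
  obtain ⟨i, hi⟩ := i
  have hterm : ∀ j : Fin (N + 1), antennaMatrix N b ⟨i, hi⟩ j * c j =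
      (fun k : ℕ => (if k + 1 = i then heunA (-(N : ℝ)) ((N : ℝ) + 4) i * p.coeff k else 0)
        + (if k = i then heunB 2 2 1 b i * p.coeff k else 0)
        + (if k = i + 1 then heunC 2 b i * p.coeff k else 0)) j := by
    intro j
    simp only [antennaMatrix, heunMatrix, Matrix.of_apply, hp, coeff_coeffPoly]
    split_ifs <;> first | omega | simp
  have htop : p.coeff (N + 1) = 0 :=
    coeff_eq_zero_of_natDegree_lt (Nat.lt_succ_of_le (natDegree_coeffPoly_le c))
  rw [Matrix.mulVec, dotProduct, Finset.sum_congr rfl fun j _ => hterm j,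
    Fin.sum_univ_eq_sum_range
      (fun k : ℕ => (if k + 1 = i then heunA (-(N : ℝ)) ((N : ℝ) + 4) i * p.coeff k else 0)
        + (if k = i then heunB 2 2 1 b i * p.coeff k else 0)
        + (if k = i + 1 then heunC 2 b i * p.coeff k else 0)),
    Finset.sum_add_distrib, Finset.sum_add_distrib, Finset.sum_ite_eq', Finset.sum_ite_eq',
    if_pos (Finset.mem_range.2 hi)]
  -- In the last row the superdiagonal entry falls outside the matrix, but there it would multiply
  -- the coefficient of `X ^ (N + 1)`, which is zero.
  have hC : (if i + 1 ∈ Finset.range (N + 1) then heunC 2 b i * p.coeff (i + 1) else 0)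
      = heunC 2 b i * p.coeff (i + 1) := by
    split_ifs with h
    · rfl
    · rw [Finset.mem_range] at h
      rw [(by omega : i = N), htop, mul_zero]
  rw [hC]
  rcases i with _ | i
  · rw [heunOp_coeff_zero]
    simp [heunB, heunC]
  · rw [heunOp_coeff_succ]
    simp only [add_left_inj]
    rw [Finset.sum_ite_eq', if_pos (Finset.mem_range.2 (by omega))]

lemma isEigenvector_iff {N : ℕ} {b q : ℝ} {c : Fin (N + 1) → ℝ} :
    IsEigenvector N b q c ↔ coeffPoly c ≠ 0 ∧ heunOp N b (coeffPoly c) = C q * coeffPoly c := by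
  rw [IsEigenvector, Module.End.hasEigenvector_iff, Module.End.mem_eigenspace_iff, and_comm, Ne,
    ← coeffPoly_eq_zero_iff]
  refine and_congr_right fun _ => ?_
  rw [Matrix.toLin'_apply]
  constructor
  · intro h
    ext n
    rw [coeff_C_mul]
    by_cases hn : n ≤ N
    · have := congrFun h ⟨n, by omega⟩
      rw [antennaMatrix_mulVec, Pi.smul_apply, smul_eq_mul, ← coeff_coeffPoly c] at this
      exact this
    · rw [heunOp_coeff_of_lt b (natDegree_coeffPoly_le c) (not_le.1 hn),
        coeff_eq_zero_of_natDegree_lt ((natDegree_coeffPoly_le _).trans_lt (not_le.1 hn)), mul_zero]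
  · intro h
    funext i
    rw [antennaMatrix_mulVec, h, coeff_C_mul, coeff_coeffPoly]
    rfl

lemma mem_eigs_iff {N : ℕ} {b q : ℝ} :
    q ∈ eigs N b ↔ ∃ p : ℝ[X], p ≠ 0 ∧ p.natDegree ≤ N ∧ heunOp N b p = C q * p := by
  constructor
  · intro h
    obtain ⟨c, hc⟩ := Module.End.HasEigenvalue.exists_hasEigenvector h
    have := isEigenvector_iff.1 hc
    exact ⟨_, this.1, natDegree_coeffPoly_le c, this.2⟩
  · rintro ⟨p, h0, hd, hp⟩
    rw [← coeffPoly_coeff hd] at h0 hp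
    exact Module.End.hasEigenvalue_of_hasEigenvector (isEigenvector_iff.2 ⟨h0, hp⟩)

/-- Since `C_n ≠ 0` for `b ≠ 0`, the three-term recurrence determines every coefficient from the
constant one. Hence eigenspaces are at most one-dimensional. -/
lemma eq_zero_of_heunOp_eq {N : ℕ} {b q : ℝ} (hb : b ≠ 0) {p : ℝ[X]}
    (hp : heunOp N b p = C q * p) (h0 : p.coeff 0 = 0) : p = 0 := by
  have h : ∀ n, p.coeff n = 0 ∧ p.coeff (n + 1) = 0 := by
    intro n
    induction n with
    | zero =>
      refine ⟨h0, ?_⟩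
      have := heunOp_coeff_zero N b p
      rw [hp, coeff_C_mul, h0, mul_zero] at this
      simpa [hb] using this
    | succ n ih =>
      refine ⟨ih.2, ?_⟩
      have := heunOp_coeff_succ N b p n
      rw [hp, coeff_C_mul, ih.1, ih.2, mul_zero, mul_zero, mul_zero, zero_add, zero_add] at this
      refine (mul_eq_zero.1 this.symm).resolve_left ?_
      rw [heunC]
      have : (0 : ℝ) ≤ ((n + 1 : ℕ) : ℝ) := Nat.cast_nonneg _
      exact mul_ne_zero (mul_ne_zero (by positivity) (by positivity)) hb
  ext n
  simpa using (h n).1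

lemma eq_C_mul_of_heunOp_eq {N : ℕ} {b q : ℝ} (hb : b ≠ 0) {p r : ℝ[X]}
    (hp : heunOp N b p = C q * p) (hr : heunOp N b r = C q * r) (h0 : p ≠ 0) :
    ∃ a : ℝ, r = C a * p := by
  have hp0 : p.coeff 0 ≠ 0 := fun h => h0 (eq_zero_of_heunOp_eq hb hp h)
  refine ⟨r.coeff 0 / p.coeff 0, ?_⟩
  refine sub_eq_zero.1 (eq_zero_of_heunOp_eq hb (q := q) (N := N) ?_ ?_)
  · rw [heunOp_sub, heunOp_C_mul, hp, hr]
    ring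
  · rw [coeff_sub, coeff_C_mul, div_mul_cancel₀ _ hp0, sub_self]

lemma eval_heunOp (N : ℕ) (b t : ℝ) (p : ℝ[X]) : (heunOp N b p).eval t =
    t * (t - 1) * (t - b) * (derivative (derivative p)).eval t
      + (5 * t ^ 2 - (4 * b + 3) * t + 2 * b) * (derivative p).eval t
      - N * (N + 4) * (t * p.eval t) := by
  simp [heunOp]

lemma solvesHeun_of_heunOp_eq {N : ℕ} {b q : ℝ} {p : ℝ[X]} (hp : heunOp N b p = C q * p) :
    SolvesHeun (-(N : ℝ)) ((N : ℝ) + 4) 2 2 1 b q p := by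
  intro t h0 h1 hb
  have h := congrArg (eval t) hp
  rw [eval_heunOp, eval_mul, eval_C] at h
  have h1' := sub_ne_zero.2 h1
  have hb' := sub_ne_zero.2 hb
  field_simp
  linear_combination h

/-! ### Equilibrium and Heun's equation -/

lemma eval_derivative_prod_X_sub_C {ι : Type*} (s : Finset ι) (τ : ι → ℝ) {x : ℝ}
    (hx : ∀ i ∈ s, x ≠ τ i) : (derivative (∏ i ∈ s, (X - C (τ i)))).eval x =
      (∏ i ∈ s, (X - C (τ i))).eval x * ∑ i ∈ s, 1 / (x - τ i) := by
  classical
  induction s using Finset.induction_on with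
  | empty => simp
  | insert i s hi ih =>
    have h := sub_ne_zero.2 (hx i (Finset.mem_insert_self i s))
    rw [Finset.prod_insert hi, Finset.sum_insert hi, derivative_mul, eval_add, eval_mul, eval_mul,
      eval_mul, ih fun j hj => hx j (Finset.mem_insert_of_mem hj)]
    simp only [derivative_sub, derivative_X, derivative_C, eval_sub, eval_X, eval_C, sub_zero,
      eval_one]
    field_simp

/-- Writing `p = (X - τ m) g` gives `p'(τ m) = g(τ m)` and `p''(τ m) = 2 g'(τ m)`, so `p''/p'` at
the root is the sum of the mutual forces. The zeroth-order term vanishes there, which is why `K` is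
arbitrary. -/
lemma eval_heunOp_prod {N : ℕ} (b : ℝ) {τ : Fin N → ℝ} (hτ : Function.Injective τ)
    (hu : ∀ m, 0 < τ m ∧ τ m < 1) (hb : ∀ m, τ m - b ≠ 0) (K : ℕ) :
    IsEquilibrium b τ ↔ ∀ m, (heunOp K b (∏ i, (X - C (τ i)))).eval (τ m) = 0 := by
  refine forall_congr' fun m => ?_
  set g : ℝ[X] := ∏ i ∈ Finset.univ.erase m, (X - C (τ i)) with hg
  have hne : ∀ i ∈ Finset.univ.erase m, τ m ≠ τ i := fun i hi h =>
    Finset.ne_of_mem_erase hi (hτ h).symm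
  have hgm : g.eval (τ m) ≠ 0 := by
    rw [hg, eval_prod]
    exact Finset.prod_ne_zero_iff.2 fun i hi => by simpa using sub_ne_zero.2 (hne i hi)
  have hp : ∏ i, (X - C (τ i)) = (X - C (τ m)) * g :=
    (Finset.mul_prod_erase _ _ (Finset.mem_univ m)).symm
  have hg' := eval_derivative_prod_X_sub_C (Finset.univ.erase m) τ hne
  rw [← hg] at hg'
  have hsum : ∑ i ∈ Finset.univ.erase m, 2 / (τ m - τ i)
      = 2 * ∑ i ∈ Finset.univ.erase m, 1 / (τ m - τ i) := by
    rw [Finset.mul_sum]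
    exact Finset.sum_congr rfl fun i _ => by ring
  rw [eval_heunOp, hp, hsum]
  simp only [derivative_mul, derivative_add, derivative_sub, derivative_X, derivative_C, eval_add,
    eval_mul, eval_sub, eval_X, eval_C, sub_zero, zero_mul, sub_self, mul_zero, add_zero, one_mul, hg']
  generalize ∑ i ∈ Finset.univ.erase m, 1 / (τ m - τ i) = S
  have h0 := (hu m).1.ne'
  have h1 := (sub_neg.2 (hu m).2).ne
  have hbm := hb m
  -- The quadratic is `t (t - 1) (t - b)` times `2 / t + 2 / (t - 1) + 1 / (t - b)`.
  have e : τ m * (τ m - 1) * (τ m - b) * (g.eval (τ m) * S + g.eval (τ m) * S)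
        + (5 * τ m ^ 2 - (4 * b + 3) * τ m + 2 * b) * g.eval (τ m)
      = τ m * (τ m - 1) * (τ m - b) * g.eval (τ m) *
        (2 * S - (-(2 / τ m) - 2 / (τ m - 1) - 1 / (τ m - b))) := by
    field_simp
    ring
  rw [e, mul_eq_zero, sub_eq_zero]
  simp [h0, h1, hbm, hgm]

/-- Since `p` is monic of degree `N`, subtracting `q p`, with `q` the coefficient of `X ^ N` in
`heunOp N b p`, leaves degree below `N` but `N` distinct zeros. -/
lemma exists_heunOp_eq {N : ℕ} {b : ℝ} {τ : Fin N → ℝ} (hτ : Function.Injective τ)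
    (h : ∀ m, (heunOp N b (∏ i, (X - C (τ i)))).eval (τ m) = 0) :
    ∃ q : ℝ, heunOp N b (∏ i, (X - C (τ i))) = C q * ∏ i, (X - C (τ i)) := by
  set p : ℝ[X] := ∏ i, (X - C (τ i)) with hp
  have hm : p.Monic := monic_prod_of_monic _ _ fun i _ => monic_X_sub_C _
  have hd : p.natDegree = N := by rw [hp, natDegree_finsetProd_X_sub_C_eq_card]; simp
  refine ⟨(heunOp N b p).coeff N, sub_eq_zero.1 ?_⟩
  refine eq_zero_of_degree_lt_of_eval_index_eq_zero (s := Finset.univ) (v := τ)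
    hτ.injOn ?_ fun m _ => ?_
  · rw [Finset.card_univ, Fintype.card_fin, degree_lt_iff_coeff_zero]
    intro n hn
    rw [coeff_sub, coeff_C_mul]
    rcases hn.eq_or_lt with rfl | hn
    · have : p.coeff N = 1 := by rw [← hd]; exact hm.coeff_natDegree
      rw [this, mul_one, sub_self]
    · rw [heunOp_coeff_of_lt b hd.le hn, coeff_eq_zero_of_natDegree_lt (hd.trans_lt hn)]
      simp
  · have : p.eval (τ m) = 0 := by
      rw [hp, eval_prod]
      exact Finset.prod_eq_zero (Finset.mem_univ m) (by simp)
    rw [eval_sub, h m, eval_mul, this, mul_zero, sub_zero]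

/-- Away from the singular points, the roots of a solution of Heun's equation are simple. -/
lemma rootMultiplicity_le_one {N : ℕ} {b q r : ℝ} {p : ℝ[X]} (hp : heunOp N b p = C q * p)
    (h0 : p ≠ 0) (hr : r * (r - 1) * (r - b) ≠ 0) : p.rootMultiplicity r ≤ 1 := by
  by_contra! hk
  set k := p.rootMultiplicity r with hkdef
  have hroot : p.IsRoot r := (rootMultiplicity_pos h0).1 (by omega)
  have h1 : (derivative p).rootMultiplicity r = k - 1 := derivative_rootMultiplicity_of_root hroot
  have hp1 : derivative p ≠ 0 := by
    intro h
    rw [h, rootMultiplicity_zero] at h1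
    omega
  have hroot1 : (derivative p).IsRoot r := (rootMultiplicity_pos hp1).1 (by omega)
  have h2 : (derivative (derivative p)).rootMultiplicity r = k - 1 - 1 := by
    rw [derivative_rootMultiplicity_of_root hroot1, h1]
  have hp2 : derivative (derivative p) ≠ 0 := by
    intro h
    have hc := derivative_eq_zero.1 h
    rw [natDegree_eq_zero] at hc
    obtain ⟨a, ha⟩ := hc
    rw [← ha, IsRoot, eval_C] at hroot1
    exact hp1 (by rw [← ha, hroot1, C_0])
  -- With `k ≥ 2`, the equation forces `(X - r) ^ (k - 1)` to divide the term in `p''`, hence `p''`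
  -- itself because the cubic does not vanish at `r`. But `p''` has multiplicity only `k - 2`.
  have d0 : (X - C r) ^ (k - 1) ∣ p := (pow_dvd_pow _ (by omega)).trans (pow_rootMultiplicity_dvd p r)
  have d1 : (X - C r) ^ (k - 1) ∣ derivative p := h1 ▸ pow_rootMultiplicity_dvd (derivative p) r
  have d2 : (X - C r) ^ (k - 1) ∣ (X * (X - 1) * (X - C b)) * derivative (derivative p) := by
    have e : (X * (X - 1) * (X - C b)) * derivative (derivative p) =
        (C q + C ((N : ℝ) * (N + 4)) * X) * p
          - (5 * X ^ 2 - C (4 * b + 3) * X + C (2 * b)) * derivative p := by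
      rw [heunOp] at hp
      linear_combination hp
    rw [e]
    exact dvd_sub (d0.mul_left _) (d1.mul_left _)
  have hcop : IsCoprime ((X - C r) ^ (k - 1)) (X * (X - 1) * (X - C b) : ℝ[X]) := by
    refine IsCoprime.pow_left ((irreducible_X_sub_C r).coprime_iff_not_dvd.2 ?_)
    rw [dvd_iff_isRoot, IsRoot]
    simpa using hr
  have := (le_rootMultiplicity_iff hp2).2 (hcop.dvd_of_dvd_mul_left d2)
  omega

lemma isConfig_cons_snoc {N : ℕ} {τ : Fin N → ℝ} (hτ : StrictMono τ)
    (hu : ∀ m, 0 < τ m ∧ τ m < 1) :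
    ∃ t : Fin (N + 2) → ℝ, IsConfig 0 1 t ∧ interior t = τ := by
  refine ⟨Fin.cons 0 (Fin.snoc τ 1 : Fin (N + 1) → ℝ), ⟨fun i j => ?_, rfl, ?_⟩, ?_⟩
  · cases i using Fin.cases with
    | zero =>
      cases j using Fin.cases with
      | zero => simp
      | succ j =>
        intro _
        cases j using Fin.lastCases with
        | last => simp
        | cast j => simpa using (hu j).1
    | succ i =>
      cases j using Fin.cases with
      | zero => simp
      | succ j =>
        rw [Fin.succ_lt_succ_iff, Fin.cons_succ, Fin.cons_succ]
        cases i using Fin.lastCases with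
        | last => intro h; exact absurd h (not_lt.2 (Fin.le_last j))
        | cast i =>
          cases j using Fin.lastCases with
          | last => intro _; simpa using (hu i).2
          | cast j =>
            intro h
            rw [Fin.snoc_castSucc, Fin.snoc_castSucc]
            exact hτ (Fin.castSucc_lt_castSucc_iff.1 h)
  · rw [← Fin.succ_last, Fin.cons_succ, Fin.snoc_last]
  · funext m
    rw [interior, ← Fin.succ_castSucc, Fin.cons_succ, Fin.snoc_castSucc]

lemma IsConfig.interior_strictMono {N : ℕ} {lo hi : ℝ} {t : Fin (N + 2) → ℝ}
    (h : IsConfig lo hi t) : StrictMono (interior t) := fun _ _ hij =>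
  h.1 (Fin.castSucc_lt_castSucc_iff.2 (Fin.succ_lt_succ_iff.2 hij))

lemma IsConfig.interior_mem {N : ℕ} {lo hi : ℝ} {t : Fin (N + 2) → ℝ} (h : IsConfig lo hi t)
    (m : Fin N) : lo < interior t m ∧ interior t m < hi := by
  constructor
  · rw [← h.2.1]
    exact h.1 (by simp [Fin.lt_def])
  · rw [← h.2.2]
    exact h.1 (Fin.castSucc_lt_last _)

/-- A solution of Heun's equation with all its roots in `(0,1)` vanishes exactly at the interior
points of an equilibrium. -/
lemma exists_equilibrium_of_allRootsInUnit {N : ℕ} {b q : ℝ} (hb : b < 0 ∨ 1 < b) {p : ℝ[X]}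
    (hp : heunOp N b p = C q * p) (h0 : p ≠ 0) (hr : AllRootsInUnit N p) :
    ∃ t : Fin (N + 2) → ℝ, IsConfig 0 1 t ∧ IsEquilibrium b (interior t) ∧
      p = C p.leadingCoeff * ∏ i, (X - C (interior t i)) := by
  obtain ⟨hd, hcard, hmem⟩ := hr
  have hnd : p.roots.Nodup := by
    rw [Multiset.nodup_iff_count_le_one]
    intro r
    rw [count_roots]
    by_cases hrt : r ∈ p.roots
    · have h := hmem r hrt
      exact rootMultiplicity_le_one hp h0 (mul_ne_zero (mul_ne_zero h.1.ne' (sub_neg.2 h.2).ne)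
        (sub_ne_zero_of_mem hb ⟨h.1.le, h.2.le⟩))
    · rw [← count_roots, Multiset.count_eq_zero_of_notMem hrt]
      exact zero_le_one
  have hfc : p.roots.toFinset.card = N := by
    rw [Multiset.toFinset_card_of_nodup hnd, hcard]
  let τ := p.roots.toFinset.orderEmbOfFin hfc
  have hu : ∀ m, 0 < τ m ∧ τ m < 1 := fun m =>
    hmem _ (Multiset.mem_toFinset.1 (Finset.orderEmbOfFin_mem _ hfc m))
  obtain ⟨t, ht, htτ⟩ := isConfig_cons_snoc τ.strictMono hu
  have hprod : p = C p.leadingCoeff * ∏ i, (X - C (τ i)) := by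
    conv_lhs => rw [← C_leadingCoeff_mul_prod_multiset_X_sub_C (hcard.trans hd.symm)]
    congr 1
    have h1 : (p.roots.map fun a => X - C a).prod = ∏ r ∈ p.roots.toFinset, (X - C r) := by
      rw [Finset.prod_multiset_map_count]
      refine Finset.prod_congr rfl fun r hr => ?_
      rw [Multiset.count_eq_one_of_mem hnd (Multiset.mem_toFinset.1 hr), pow_one]
    rw [h1, ← Finset.image_orderEmbOfFin_univ p.roots.toFinset hfc,
      Finset.prod_image fun i _ j _ h => τ.injective h]
  refine ⟨t, ht, ?_, by rw [htτ]; exact hprod⟩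
  rw [htτ, eval_heunOp_prod b τ.injective hu
    (fun m => sub_ne_zero_of_mem hb ⟨(hu m).1.le, (hu m).2.le⟩) N]
  intro m
  have hlc : p.leadingCoeff ≠ 0 := leadingCoeff_ne_zero.2 h0
  have h1 : C p.leadingCoeff * heunOp N b (∏ i, (X - C (τ i))) = C q * p := by
    rw [← heunOp_C_mul, ← hprod, hp]
  have h2 := congrArg (eval (τ m)) h1
  have h3 : p.eval (τ m) = 0 := by
    rw [hprod, eval_mul, eval_prod, Finset.prod_eq_zero (Finset.mem_univ m) (by simp), mul_zero]
  rw [eval_mul, eval_mul, h3, mul_zero, eval_C] at h2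
  exact (mul_eq_zero.1 h2).resolve_left hlc

lemma roots_C_mul_prod {N : ℕ} (τ : Fin N → ℝ) {a : ℝ} (ha : a ≠ 0) :
    (C a * ∏ i, (X - C (τ i))).roots = (Finset.univ : Finset (Fin N)).val.map τ := by
  rw [roots_C_mul _ ha]
  rw [← roots_multiset_prod_X_sub_C ((Finset.univ : Finset (Fin N)).val.map τ), Multiset.map_map]
  rfl

lemma allRootsInUnit_C_mul_prod {N : ℕ} {τ : Fin N → ℝ} (hu : ∀ m, 0 < τ m ∧ τ m < 1) {a : ℝ}
    (ha : a ≠ 0) : AllRootsInUnit N (C a * ∏ i, (X - C (τ i))) := by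
  refine ⟨?_, ?_, ?_⟩
  · rw [natDegree_C_mul ha, natDegree_finsetProd_X_sub_C_eq_card]
    simp
  · rw [roots_C_mul_prod τ ha]
    simp
  · rw [roots_C_mul_prod τ ha]
    intro r hr
    obtain ⟨m, -, rfl⟩ := Multiset.mem_map.1 hr
    exact hu m

/-- For `b` outside `[0,1]` there is an optimal choice of the eigenvalue. -/
lemma exists_isOptimalChoice (N : ℕ) {b : ℝ} (hb : b < 0 ∨ 1 < b) :
    ∃ q : ℝ, IsOptimalChoice N b q ∧
      ∃ τ : Fin N → ℝ, (∀ m, 0 < τ m ∧ τ m < 1) ∧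
        heunOp N b (∏ i, (X - C (τ i))) = C q * ∏ i, (X - C (τ i)) := by
  obtain ⟨t, ht, he⟩ := exists_equilibrium N hb
  have hu := ht.interior_mem
  have hinj := ht.interior_strictMono.injective
  have hb0 : b ≠ 0 := by rcases hb with h | h <;> linarith
  obtain ⟨q, hq⟩ := exists_heunOp_eq hinj ((eval_heunOp_prod b hinj hu
    (fun m => sub_ne_zero_of_mem hb ⟨(hu m).1.le, (hu m).2.le⟩) N).1 he)
  set p : ℝ[X] := ∏ i, (X - C (interior t i)) with hp
  have hm : p.Monic := monic_prod_of_monic _ _ fun i _ => monic_X_sub_C _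
  have hpr : AllRootsInUnit N p := by
    have := allRootsInUnit_C_mul_prod hu one_ne_zero
    rwa [C_1, one_mul] at this
  have hform : ∀ c, IsEigenvector N b q c → ∃ a : ℝ, a ≠ 0 ∧ coeffPoly c = C a * p := by
    intro c hc
    obtain ⟨h0, hc⟩ := isEigenvector_iff.1 hc
    obtain ⟨a, ha⟩ := eq_C_mul_of_heunOp_eq hb0 hq hc hm.ne_zero
    exact ⟨a, fun h => h0 (by rw [ha, h, C_0, zero_mul]), ha⟩
  refine ⟨q, ⟨mem_eigs_iff.2 ⟨p, hm.ne_zero, hpr.1.le, hq⟩, fun q' c hc => ⟨fun hr => ?_, ?_⟩,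
    fun c hc => solvesHeun_of_heunOp_eq (isEigenvector_iff.1 hc).2, t, ht, fun c hc => ?_, he,
    fun t' ht' he' => equilibrium_unique hb ht he ht' he', ?_⟩, interior t, hu, hq⟩
  -- Uniqueness of the equilibrium makes this eigenpolynomial a multiple of `p`, so its eigenvalue
  -- is `q`.
  · obtain ⟨h0, hc⟩ := isEigenvector_iff.1 hc
    obtain ⟨t', ht', he', hprod⟩ := exists_equilibrium_of_allRootsInUnit hb hc h0 hr
    rw [equilibrium_unique hb ht he ht' he', ← hp] at hprod
    have h1 := hc
    rw [hprod, heunOp_C_mul, hq, ← mul_assoc, ← mul_assoc, mul_comm (C _) (C q), mul_assoc,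
      mul_assoc, ← hprod] at h1
    exact (C_injective (mul_right_cancel₀ h0 h1)).symm
  · rintro rfl
    obtain ⟨a, ha, hc⟩ := hform c hc
    rw [hc]
    exact allRootsInUnit_C_mul_prod hu ha
  · obtain ⟨a, ha, hc⟩ := hform c hc
    rw [hc, hp, roots_C_mul_prod _ ha]
  · rintro G hG rfl
    exact Geometry.isUniqueOptimum_of_equilibrium hG hb ht he


/-! ### Comparison of eigenvalues -/

/-- If `v` is an eigenvector for `q` without zero entries, and conjugation by `v` makes the
off-diagonal entries of `M` nonnegative, then every real eigenvalue of `M` is at most `q`. -/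
lemma eigenvalue_le_of_mulVec_eq {n : Type*} [Fintype n] {M : Matrix n n ℝ} {v w : n → ℝ} {q μ : ℝ}
    (hv : ∀ i, v i ≠ 0) (hM : ∀ i j, i ≠ j → 0 ≤ M i j * v i * v j)
    (hq : M.mulVec v = q • v) (hμ : M.mulVec w = μ • w) (hw : w ≠ 0) : μ ≤ q := by
  obtain ⟨i₀, hi₀⟩ := Function.ne_iff.1 hw
  have : Nonempty n := ⟨i₀⟩
  -- Put `x = w / v` and take the row where `|x|` is maximal. There `x j * x i ≤ x i ^ 2`, so the
  -- nonnegative off-diagonal weights bound row `i` of the equation for `w` by that for `v`.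
  obtain ⟨i, hi⟩ := Finite.exists_max fun i => |w i / v i|
  have hxi : 0 < (w i / v i) ^ 2 := by
    rw [← sq_abs]
    have := (abs_pos.2 (div_ne_zero hi₀ (hv i₀))).trans_le (hi i₀)
    positivity
  have h1 : ∑ j, M i j * v i * v j = q * v i ^ 2 := by
    have := congrFun hq i
    rw [Matrix.mulVec, dotProduct, Pi.smul_apply, smul_eq_mul] at this
    rw [pow_two, ← mul_assoc, ← this, Finset.sum_mul]
    exact Finset.sum_congr rfl fun j _ => by ring
  have h2 : ∑ j, M i j * v i * v j * ((w j / v j) * (w i / v i)) =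
      μ * v i ^ 2 * (w i / v i) ^ 2 := by
    have := congrFun hμ i
    rw [Matrix.mulVec, dotProduct, Pi.smul_apply, smul_eq_mul] at this
    have e : μ * v i ^ 2 * (w i / v i) ^ 2 = μ * w i * w i := by
      have := hv i
      field_simp
    rw [e, ← this, Finset.sum_mul]
    refine Finset.sum_congr rfl fun j _ => ?_
    have := hv i
    have := hv j
    field_simp
  have h3 : ∑ j, M i j * v i * v j * ((w j / v j) * (w i / v i)) ≤
      ∑ j, M i j * v i * v j * (w i / v i) ^ 2 := by
    refine Finset.sum_le_sum fun j _ => ?_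
    rcases eq_or_ne i j with rfl | hij
    · rw [pow_two]
    · refine mul_le_mul_of_nonneg_left ?_ (hM i j hij)
      calc (w j / v j) * (w i / v i) ≤ |w j / v j| * |w i / v i| := by
            rw [← abs_mul]; exact le_abs_self _
        _ ≤ |w i / v i| * |w i / v i| := mul_le_mul_of_nonneg_right (hi j) (abs_nonneg _)
        _ = (w i / v i) ^ 2 := by rw [← pow_two, sq_abs]
  rw [h2, ← Finset.sum_mul, h1] at h3
  exact le_of_mul_le_mul_right (le_of_mul_le_mul_right h3 hxi) (pow_pos (abs_pos.2 (hv i)) 2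
    |>.trans_eq (sq_abs _))

/-- The coefficients of a polynomial with positive roots alternate in sign. -/
lemma coeff_prod_X_sub_C_sign {ι : Type*} (s : Finset ι) (τ : ι → ℝ) (h : ∀ i ∈ s, 0 < τ i) :
    (∀ n, 0 ≤ (-1) ^ (s.card + n) * (∏ i ∈ s, (X - C (τ i))).coeff n) ∧
      ∀ n ≤ s.card, 0 < (-1) ^ (s.card + n) * (∏ i ∈ s, (X - C (τ i))).coeff n := by
  classical
  induction s using Finset.induction_on with
  | empty =>
    constructor
    · intro n
      rcases n with _ | n <;> simp [coeff_one]
    · intro n hn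
      obtain rfl : n = 0 := by simpa using hn
      simp
  | insert i s hi ih =>
    obtain ⟨ih1, ih2⟩ := ih fun j hj => h j (Finset.mem_insert_of_mem hj)
    have hr := h i (Finset.mem_insert_self i s)
    rw [Finset.prod_insert hi, Finset.card_insert_of_notMem hi]
    set g := ∏ i ∈ s, (X - C (τ i)) with hg
    have e0 : (-1) ^ (s.card + 1 + 0) * ((X - C (τ i)) * g).coeff 0 =
        τ i * ((-1) ^ (s.card + 0) * g.coeff 0) := by
      rw [sub_mul, coeff_sub, mul_coeff_zero, coeff_X_zero, coeff_C_mul]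
      ring
    have e1 : ∀ n, (-1) ^ (s.card + 1 + (n + 1)) * ((X - C (τ i)) * g).coeff (n + 1) =
        (-1) ^ (s.card + n) * g.coeff n + τ i * ((-1) ^ (s.card + (n + 1)) * g.coeff (n + 1)) := by
      intro n
      rw [sub_mul, coeff_sub, coeff_X_mul, coeff_C_mul]
      ring
    constructor
    · intro n
      rcases n with _ | n
      · rw [e0]
        exact mul_nonneg hr.le (ih1 0)
      · rw [e1]
        exact add_nonneg (ih1 n) (mul_nonneg hr.le (ih1 _))
    · intro n hn
      rcases n with _ | n
      · rw [e0]
        exact mul_pos hr (ih2 0 (Nat.zero_le _))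
      · rw [e1]
        -- At the top index the second term is zero, so only the weak sign, which holds for all `n`,
        -- can be used for it.
        exact add_pos_of_pos_of_nonneg (ih2 n (by omega)) (mul_nonneg hr.le (ih1 _))

lemma heunA_neg {N n : ℕ} (hn : n ≤ N) : heunA (-(N : ℝ)) ((N : ℝ) + 4) n < 0 := by
  have h : (n : ℝ) ≤ N := by exact_mod_cast hn
  have h0 : (0 : ℝ) ≤ n := n.cast_nonneg
  exact mul_neg_of_neg_of_pos (by linarith) (by linarith)

lemma heunC_neg {b : ℝ} (hb : b < 0) (n : ℕ) : heunC 2 b n < 0 :=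
  mul_neg_of_pos_of_neg (by positivity) hb

lemma antennaMatrix_nonpos {N : ℕ} {b : ℝ} (hb : b < 0) {i j : Fin (N + 1)} (hij : i ≠ j) :
    antennaMatrix N b i j ≤ 0 := by
  have hne : (j : ℕ) ≠ i := fun h => hij (Fin.ext h.symm)
  simp only [antennaMatrix, heunMatrix, Matrix.of_apply]
  split_ifs
  · exact (heunA_neg (by omega)).le
  · exact (heunC_neg hb _).le
  · exact le_rfl

lemma antennaMatrix_eq_zero {N : ℕ} {b : ℝ} {i j : Fin (N + 1)} (hij : i ≠ j)
    (h1 : (j : ℕ) + 1 ≠ i) (h2 : (i : ℕ) + 1 ≠ j) : antennaMatrix N b i j = 0 := by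
  have hne : (j : ℕ) ≠ i := fun h => hij (Fin.ext h.symm)
  simp only [antennaMatrix, heunMatrix, Matrix.of_apply]
  rw [if_neg h1, if_neg hne, if_neg (Ne.symm h2)]

/-- For `b < 0` the eigenvalue of a polynomial with roots in `(0,1)` is the largest one. -/
lemma isGreatest_eigs {N : ℕ} {b q : ℝ} (hb : b < 0) {τ : Fin N → ℝ} (hτ : ∀ m, 0 < τ m)
    (hq : heunOp N b (∏ i, (X - C (τ i))) = C q * ∏ i, (X - C (τ i))) :
    IsGreatest (eigs N b) q := by
  set p : ℝ[X] := ∏ i, (X - C (τ i)) with hp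
  have hp0 : p ≠ 0 := (monic_prod_of_monic _ _ fun i _ => monic_X_sub_C _).ne_zero
  have hd : p.natDegree ≤ N := by rw [hp, natDegree_finsetProd_X_sub_C_eq_card]; simp
  have hs : ∀ n ≤ N, 0 < (-1) ^ (N + n) * p.coeff n := by
    simpa using (coeff_prod_X_sub_C_sign Finset.univ τ fun i _ => hτ i).2
  refine ⟨mem_eigs_iff.2 ⟨p, hp0, hd, hq⟩, fun μ hμ => ?_⟩
  obtain ⟨w, hw⟩ := Module.End.HasEigenvalue.exists_hasEigenvector hμ
  have hv : IsEigenvector N b q fun m => p.coeff m :=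
    isEigenvector_iff.2 (by rw [coeffPoly_coeff hd]; exact ⟨hp0, hq⟩)
  -- Neighbouring coefficients have opposite signs; against nonpositive off-diagonal entries this
  -- gives the sign condition of the comparison lemma.
  have hadj : ∀ n, n + 1 ≤ N → p.coeff (n + 1) * p.coeff n ≤ 0 := by
    intro n hn
    have h := mul_pos (hs (n + 1) hn) (hs n (by omega))
    have e : (-1 : ℝ) ^ (N + (n + 1)) * p.coeff (n + 1) * ((-1) ^ (N + n) * p.coeff n) =
        -(((-1) ^ (N + n)) ^ 2 * (p.coeff (n + 1) * p.coeff n)) := by ring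
    rw [e, ← pow_mul, mul_comm (N + n), pow_mul, neg_one_sq, one_pow, one_mul] at h
    linarith
  refine eigenvalue_le_of_mulVec_eq (fun i h => ?_) (fun i j hij => ?_)
    (by simpa using hv.apply_eq_smul) (by simpa using hw.apply_eq_smul) hw.2
  · have := hs i (by omega)
    rw [h, mul_zero] at this
    exact lt_irrefl _ this
  · rw [mul_assoc]
    by_cases h1 : (j : ℕ) + 1 = i
    · refine mul_nonneg_of_nonpos_of_nonpos (antennaMatrix_nonpos hb hij) ?_
      simp only [← h1]
      exact hadj j (by omega)
    · by_cases h2 : (i : ℕ) + 1 = j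
      · refine mul_nonneg_of_nonpos_of_nonpos (antennaMatrix_nonpos hb hij) ?_
        simp only [← h2]
        rw [mul_comm]
        exact hadj i (by omega)
      · rw [antennaMatrix_eq_zero hij h1 h2, zero_mul]

/-! ### The number of eigenvalues -/

/-- A matrix in detailed balance with positive weights `d` whose eigenspaces are at most
one-dimensional has as many real eigenvalues as rows. -/
lemma exists_injective_eigenvalues {n : Type*} [Fintype n] [DecidableEq n] {M : Matrix n n ℝ}
    {d : n → ℝ} (hd : ∀ i, 0 < d i) (hM : ∀ i j, d i * M i j = d j * M j i)
    (h1 : ∀ (q : ℝ) (v w : n → ℝ), M.mulVec v = q • v → M.mulVec w = q • w → v ≠ 0 →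
      ∃ a : ℝ, w = a • v) :
    ∃ ev : n → ℝ, Function.Injective ev ∧
      ∀ i, Module.End.HasEigenvalue (Matrix.toLin' M) (ev i) := by
  have hs : ∀ i, 0 < Real.sqrt (d i) := fun i => Real.sqrt_pos.2 (hd i)
  -- Detailed balance says that `D^(1/2) M D^(-1/2)` is symmetric, where `D = diag d`.
  let S : Matrix n n ℝ := Matrix.of fun i j => Real.sqrt (d i) * M i j / Real.sqrt (d j)
  have hS : S.IsHermitian := by
    ext i j
    simp only [S, Matrix.conjTranspose_apply, Matrix.of_apply, star_trivial]
    rw [div_eq_div_iff (hs i).ne' (hs j).ne']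
    have := hM i j
    rw [← Real.mul_self_sqrt (hd i).le, ← Real.mul_self_sqrt (hd j).le] at this
    linarith
  let u : n → n → ℝ := fun k => hS.eigenvectorBasis k
  have hu0 : ∀ k, u k ≠ 0 := fun k h =>
    hS.eigenvectorBasis.orthonormal.ne_zero k (by ext i; exact congrFun h i)
  let c : n → n → ℝ := fun k i => u k i / Real.sqrt (d i)
  have hcu : ∀ k i, u k i = c k i * Real.sqrt (d i) := fun k i =>
    (div_mul_cancel₀ _ (hs i).ne').symm
  have hc0 : ∀ k, c k ≠ 0 := fun k h => hu0 k (by funext i; rw [hcu, h]; simp)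
  have hc : ∀ k, M.mulVec (c k) = hS.eigenvalues k • c k := by
    intro k
    funext i
    have h := congrFun (hS.mulVec_eigenvectorBasis k) i
    have h' : ∑ j, S i j * u k j = hS.eigenvalues k * u k i := h
    have e : ∑ j, S i j * u k j = Real.sqrt (d i) * ∑ j, M i j * c k j := by
      rw [Finset.mul_sum]
      refine Finset.sum_congr rfl fun j _ => ?_
      have := (hs j).ne'
      simp only [S, Matrix.of_apply, hcu]
      field_simp
    rw [e, hcu, ← mul_assoc, mul_comm] at h'
    exact mul_right_cancel₀ (hs i).ne' h'
  refine ⟨hS.eigenvalues, fun k l hkl => ?_, fun k =>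
    Module.End.hasEigenvalue_of_hasEigenvector (x := c k)
      (Module.End.hasEigenvector_iff.2 ⟨Module.End.mem_eigenspace_iff.2 (by simpa using hc k), hc0 k⟩)⟩
  by_contra hne
  -- A repeated eigenvalue would make two vectors of the orthonormal basis proportional.
  obtain ⟨a, ha⟩ := h1 _ _ _ (hc k) (hkl ▸ hc l) (hc0 k)
  have hul : hS.eigenvectorBasis l = a • hS.eigenvectorBasis k := by
    ext i
    have : u l i = a * u k i := by
      rw [hcu, hcu, ha, Pi.smul_apply, smul_eq_mul, mul_assoc]
    exact this
  have ho : inner ℝ (hS.eigenvectorBasis k) (hS.eigenvectorBasis l) = 0 :=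
    hS.eigenvectorBasis.orthonormal.2 hne
  rw [hul, inner_smul_right, real_inner_self_eq_norm_sq, hS.eigenvectorBasis.orthonormal.1 k,
    one_pow, mul_one] at ho
  refine hS.eigenvectorBasis.orthonormal.ne_zero l ?_
  rw [hul, ho, zero_smul]

/-- Weights for which the antenna matrix is in detailed balance. -/
def balanceWeight (N : ℕ) (b : ℝ) (n : ℕ) : ℝ :=
  ∏ k ∈ Finset.range n, heunC 2 b k / heunA (-(N : ℝ)) ((N : ℝ) + 4) (k + 1 : ℕ)

/-- For `b < 0` both `C_k` and `A_{k+1}` are negative in the range used. -/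
lemma balanceWeight_pos {N : ℕ} {b : ℝ} (hb : b < 0) {n : ℕ} (hn : n ≤ N) :
    0 < balanceWeight N b n :=
  Finset.prod_pos fun k hk => div_pos_of_neg_of_neg (heunC_neg hb k)
    (heunA_neg (by have := Finset.mem_range.1 hk; omega))

lemma balanceWeight_succ_mul {N n : ℕ} (b : ℝ) (hn : n + 1 ≤ N) :
    balanceWeight N b (n + 1) * heunA (-(N : ℝ)) ((N : ℝ) + 4) (n + 1 : ℕ) =
      balanceWeight N b n * heunC 2 b n := by
  rw [balanceWeight, Finset.prod_range_succ, mul_assoc, div_mul_cancel₀ _ (heunA_neg hn).ne,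
    balanceWeight]

lemma balanceWeight_mul_antennaMatrix {N : ℕ} (b : ℝ) (i j : Fin (N + 1)) :
    balanceWeight N b i * antennaMatrix N b i j = balanceWeight N b j * antennaMatrix N b j i := by
  have key : ∀ i j : Fin (N + 1), (j : ℕ) + 1 = i →
      balanceWeight N b i * antennaMatrix N b i j =
        balanceWeight N b j * antennaMatrix N b j i := by
    intro i j h
    simp only [antennaMatrix, heunMatrix, Matrix.of_apply]
    rw [if_pos h, if_neg (by omega), if_neg (by omega), if_pos h.symm, ← h]
    exact balanceWeight_succ_mul b (by omega)
  rcases eq_or_ne i j with rfl | hij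
  · rfl
  by_cases h1 : (j : ℕ) + 1 = i
  · exact key i j h1
  by_cases h2 : (i : ℕ) + 1 = j
  · exact (key j i h2).symm
  rw [antennaMatrix_eq_zero hij h1 h2, antennaMatrix_eq_zero hij.symm h2 h1, mul_zero, mul_zero]

lemma ncard_eigs_of_neg (N : ℕ) {b : ℝ} (hb : b < 0) : (eigs N b).ncard = N + 1 := by
  have key : ∀ (q : ℝ) (v : Fin (N + 1) → ℝ), (antennaMatrix N b).mulVec v = q • v → v ≠ 0 →
      IsEigenvector N b q v := fun q v hv h0 =>
    Module.End.hasEigenvector_iff.2 ⟨Module.End.mem_eigenspace_iff.2 (by simpa using hv), h0⟩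
  obtain ⟨ev, hinj, hev⟩ := exists_injective_eigenvalues (M := antennaMatrix N b)
    (d := fun i => balanceWeight N b i) (fun i => balanceWeight_pos hb (by omega))
    (balanceWeight_mul_antennaMatrix b) fun q v w hv hw h0 => by
      by_cases hw0 : w = 0
      · exact ⟨0, by rw [hw0, zero_smul]⟩
      obtain ⟨hv1, hv2⟩ := isEigenvector_iff.1 (key q v hv h0)
      obtain ⟨a, ha⟩ := eq_C_mul_of_heunOp_eq hb.ne hv2 (isEigenvector_iff.1 (key q w hw hw0)).2 hv1
      refine ⟨a, ?_⟩
      funext i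
      rw [← coeff_coeffPoly w, ha, coeff_C_mul, coeff_coeffPoly, Pi.smul_apply, smul_eq_mul]
  have hsub : eigs N b ⊆ (antennaMatrix N b).charpoly.roots.toFinset := by
    intro q hq
    have h := (Module.End.hasEigenvalue_iff_isRoot_charpoly _ _).1 hq
    rw [Matrix.charpoly_toLin'] at h
    simpa [(Matrix.charpoly_monic _).ne_zero] using h
  apply le_antisymm
  · calc (eigs N b).ncard ≤ ((antennaMatrix N b).charpoly.roots.toFinset : Set ℝ).ncard :=
        Set.ncard_le_ncard hsub (Finset.finite_toSet _)
      _ ≤ N + 1 := by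
        rw [Set.ncard_coe_finset]
        refine (Multiset.toFinset_card_le _).trans ((card_roots' _).trans ?_)
        rw [Matrix.charpoly_natDegree_eq_dim, Fintype.card_fin]
  · calc N + 1 = (Set.range ev).ncard := by
          rw [← Set.image_univ, Set.ncard_image_of_injective _ hinj, Set.ncard_univ]
          simp
      _ ≤ (eigs N b).ncard :=
        Set.ncard_le_ncard (Set.range_subset_iff.2 hev) ((Finset.finite_toSet _).subset hsub)

/-! ### Reflection `t ↦ 1 - t` -/

/-- The substitution swaps the equal charges at `0` and `1`, moves `b` to `1 - b` and changes the
sign of the cubic. The term `X p` becomes `(1 - X) p`, which accounts for the shift by `N (N + 4)`.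
-/
lemma heunOp_comp_one_sub (N : ℕ) (b : ℝ) (p : ℝ[X]) : heunOp N b (p.comp (1 - X)) =
    -(heunOp N (1 - b) p).comp (1 - X) - C ((N : ℝ) * (N + 4)) * p.comp (1 - X) := by
  have d : ∀ r : ℝ[X], derivative (r.comp (1 - X)) = -(derivative r).comp (1 - X) := by
    intro r
    rw [derivative_comp]
    simp
  simp only [heunOp, d, derivative_neg, add_comp, sub_comp, mul_comp, X_comp, C_comp, one_comp,
    pow_comp, ofNat_comp, neg_neg, map_sub, map_add, map_mul, map_one, map_ofNat]
  ring

lemma heunOp_comp_one_sub_eq {N : ℕ} {b q : ℝ} {p : ℝ[X]} (hp : heunOp N (1 - b) p = C q * p) :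
    heunOp N b (p.comp (1 - X)) = C (-q - N * (N + 4)) * p.comp (1 - X) := by
  rw [heunOp_comp_one_sub, hp, mul_comp, C_comp, map_sub, map_neg]
  ring

lemma reflect_mem_eigs {N : ℕ} {b q : ℝ} (hq : q ∈ eigs N (1 - b)) :
    -q - N * (N + 4) ∈ eigs N b := by
  obtain ⟨p, h0, hd, hp⟩ := mem_eigs_iff.1 hq
  have hdX : (1 - X : ℝ[X]).natDegree = 1 := by
    rw [← natDegree_neg, neg_sub]
    exact natDegree_X_sub_C 1
  refine mem_eigs_iff.2 ⟨p.comp (1 - X), fun h => h0 ?_, ?_, heunOp_comp_one_sub_eq hp⟩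
  · have := congrArg (fun r : ℝ[X] => r.comp (1 - X)) h
    simpa [comp_assoc] using this
  · rw [natDegree_comp, hdX, mul_one]
    exact hd

lemma eigs_eq_image_reflect (N : ℕ) (b : ℝ) :
    eigs N b = (fun q : ℝ => -q - N * (N + 4)) '' eigs N (1 - b) := by
  apply Set.Subset.antisymm
  · intro q hq
    refine ⟨-q - N * (N + 4), reflect_mem_eigs (by rwa [sub_sub_cancel]), by ring⟩
  · rintro _ ⟨q, hq, rfl⟩
    exact reflect_mem_eigs hq

/-- The map `q ↦ -q - N (N + 4)` is decreasing, so the greatest eigenvalue for `1 - b < 0`, attached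
to the positive roots `1 - τ`, becomes the least one for `b`. -/
lemma isLeast_eigs {N : ℕ} {b q : ℝ} (hb : 1 < b) {τ : Fin N → ℝ} (hτ : ∀ m, τ m < 1)
    (hq : heunOp N b (∏ i, (X - C (τ i))) = C q * ∏ i, (X - C (τ i))) :
    IsLeast (eigs N b) q := by
  set K : ℝ := N * (N + 4)
  have e : (∏ i, (X - C (τ i))).comp (1 - X) =
      C ((-1) ^ N) * ∏ i, (X - C (1 - τ i)) := by
    rw [prod_comp, map_pow, map_neg, map_one]
    have : ∀ i, (X - C (τ i)).comp (1 - X) = -1 * (X - C (1 - τ i)) := by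
      intro i
      simp only [sub_comp, X_comp, C_comp, map_sub, map_one]
      ring
    rw [Finset.prod_congr rfl fun i _ => this i, Finset.prod_mul_distrib]
    simp
  have h := heunOp_comp_one_sub_eq (b := 1 - b) (by rwa [sub_sub_cancel])
  rw [e, heunOp_C_mul, mul_left_comm] at h
  have hg := isGreatest_eigs (by linarith : 1 - b < 0) (fun m => sub_pos.2 (hτ m))
    (mul_left_cancel₀ (C_ne_zero.2 (pow_ne_zero N (by norm_num))) h)
  refine ⟨?_, fun μ hμ => ?_⟩
  · have := reflect_mem_eigs hg.1
    rwa [neg_sub, sub_neg_eq_add, add_sub_cancel_left] at this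
  · have := hg.2 (reflect_mem_eigs (b := 1 - b) (by rwa [sub_sub_cancel]))
    linarith

lemma ncard_eigs (N : ℕ) {b : ℝ} (hb : b < 0 ∨ 1 < b) : (eigs N b).ncard = N + 1 := by
  rcases hb with hb | hb
  · exact ncard_eigs_of_neg N hb
  · rw [eigs_eq_image_reflect, Set.ncard_image_of_injective, ncard_eigs_of_neg N (by linarith)]
    intro x y h
    simpa using h

end NearField

end

theorem corollary1 (N : ℕ) (bt : ℝ) :
    (bt < 0 ∨ 1 < bt → (NearField.eigs N bt).ncard = N + 1) ∧
    (bt < 0 → ∃ q : ℝ, IsGreatest (NearField.eigs N bt) q ∧ NearField.IsOptimalChoice N bt q) ∧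
    (1 < bt → ∃ q : ℝ, IsLeast (NearField.eigs N bt) q ∧ NearField.IsOptimalChoice N bt q) := by
  refine ⟨NearField.ncard_eigs N, fun hb => ?_, fun hb => ?_⟩
  · obtain ⟨q, hq, τ, hτ, h⟩ := NearField.exists_isOptimalChoice N (Or.inl hb)
    exact ⟨q, NearField.isGreatest_eigs hb (fun m => (hτ m).1) h, hq⟩
  · obtain ⟨q, hq, τ, hτ, h⟩ := NearField.exists_isOptimalChoice N (Or.inr hb)
    exact ⟨q, NearField.isLeast_eigs hb (fun m => (hτ m).2) h, hq⟩
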